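/- Let $Q$ be a finite-dimensional smooth manifold, $\pi_Q:T^*Q\to Q$ its cotangent bundle, and $\omega_Q=-d\theta=dq^A\wedge dp_A$ the canonical symplectic form ($\theta=p_A\,dq^A$ the Liouville form). Let $L:TQ\to\mathbb R$ be a smooth Lagrangian with Legendre mapping (fibre derivative) $FL:TQ\to T^*Q$ and energy $E_L(v)=\langle FL(v),v\rangle-L(v)$. Assume that $L$ is almost regular: $M_1=FL(TQ)$ is an embedded submanifold of $T^*Q$, and $FL:TQ\to M_1$ is a submersion with connected fibres. Let $h_1:M_1\to\mathbb R$ be the function with $h_1\circ FL=E_L$, and let $\omega_1$ be the pullback of $\omega_Q$ to $M_1$. Define the constraint algorithm by $$M_{l+1}=\{p\in M_l : \text{there is } x\in T_pM_l \text{ with } \omega_1(x,y)=dh_1(p)(y)\ \text{for all } y\in T_pM_1\},\qquad l\ge 1 .$$ Suppose that it stabilizes, $M_{f+1}=M_f$ for some $f\ge 1$, and that for all $1\le r\le f$ the set $M_r$ is an embedded submanifold of $T^*Q$, $Q_r=\pi_Q(M_r)$ is an embedded submanifold of $Q$, and the projection $\pi_r=\pi_Q|_{M_r}:M_r\to Q_r$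 is a fibration (a surjective submersion). Let $\gamma$ be a closed smooth $1$-form on $Q$ such that $\gamma(Q)\subset M_1$ and $\gamma(Q_f)\subset M_f$, and let $\gamma_f:Q_f\to M_f$ be the restriction of $\gamma$. Let $X$ be a smooth vector field on $M_f$ (tangent to $M_f$) that solves $i_X\omega_1=dh_1$ along $M_f$, i.e. $\omega_1(X(p),y)=dh_1(p)(y)$ for all $p\in M_f$ and $y\in T_pM_1$. Put $X^\gamma=T\pi_f\circ X\circ\gamma_f$, a vector field on $Q_f$. Then the following are equivalent: 1. $X$ and $X^\gamma$ are $\gamma_f$-related, i.e. $T_q\gamma_f(X^\gamma(q))=X(\gamma(q))$ for all $q\in Q_f$; 2. $d(h_1\circ\gamma)(q)=0$ in $T_q^*Q$ for all $q\in Q_f$. -/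

import Mathlib

open Set Bundle
open scoped Manifold ContDiff Topology

noncomputable section

namespace HamiltonJacobi

section Manifolds

variable {E : Type*} [NormedAddCommGroup E] [NormedSpace ℝ E]
  {H : Type*} [TopologicalSpace H] (I : ModelWithCorners ℝ E H)
  {M : Type*} [TopologicalSpace M] [ChartedSpace H M]
  {E' : Type*} [NormedAddCommGroup E'] [NormedSpace ℝ E']
  {H' : Type*} [TopologicalSpace H'] (J : ModelWithCorners ℝ E' H')
  {N : Type*} [TopologicalSpace N] [ChartedSpace H' N]

/-- `S` is an embedded submanifold of `M`: around each of its points there is a chart of the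
smooth structure of `M` in which `S` is cut out by a linear subspace of the model space. -/
def IsEmbeddedSubmanifold (S : Set M) : Prop :=
  ∀ p ∈ S, ∃ φ ∈ IsManifold.maximalAtlas I ∞ M, p ∈ φ.source ∧
    ∃ W : Submodule ℝ E, ∀ x ∈ φ.source, x ∈ S ↔ I (φ x) ∈ W

/-- The tangent space `T_p S` of a submanifold `S` of `M`, as a subset of `T_p M`: the velocities
at time `0` of the smooth curves through `p` that stay in `S`. -/
def tangentTo (S : Set M) (p : M) : Set (TangentSpace I p) :=
  {v | ∃ c : ℝ → M, ContMDiffAt 𝓘(ℝ, ℝ) I ∞ c 0 ∧ (∀ᶠ t in 𝓝 (0 : ℝ), c t ∈ S) ∧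
    tangentMap 𝓘(ℝ, ℝ) I c ⟨0, (1 : ℝ)⟩ = ⟨p, v⟩}

/-- The restriction of the smooth map `f : M → N` to the submanifold `S` of `M` is a
surjective submersion `S → T` onto the submanifold `T` of `N`. -/
structure IsSurjectiveSubmersion (f : M → N) (S : Set M) (T : Set N) : Prop where
  contMDiff : ContMDiff I J ∞ f
  mapsTo : MapsTo f S T
  surjOn : SurjOn f S T
  surj_tangent : ∀ p ∈ S, SurjOn (mfderiv I J f p) (tangentTo I S p) (tangentTo J T (f p))

/-- The `1`-form `θ` on `M`, written in the preferred chart at `p`: the pullback of `θ` by the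
inverse of that chart. -/
def oneFormInChart (θ : ∀ p : M, TangentSpace I p →L[ℝ] ℝ) (p : M) (y : E) : E →L[ℝ] ℝ :=
  (θ ((extChartAt I p).symm y)).comp
    (mfderivWithin 𝓘(ℝ, E) I (extChartAt I p).symm (range I) y)

/-- The exterior derivative of the `1`-form `θ`: in the chart at `p`,
`dθ(u, v) = (D_u θ)(v) - (D_v θ)(u)`. (In Mathlib a tangent vector at `p` is its coordinate
vector in the preferred chart at `p`.) -/
def extDerivOneForm (θ : ∀ p : M, TangentSpace I p →L[ℝ] ℝ) (p : M)
    (u v : TangentSpace I p) : ℝ :=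
  (fderivWithin ℝ (oneFormInChart I θ p) (range I) (extChartAt I p p) u : E →L[ℝ] ℝ) v -
    (fderivWithin ℝ (oneFormInChart I θ p) (range I) (extChartAt I p p) v : E →L[ℝ] ℝ) u

end Manifolds

section Lagrangian

variable {E : Type*} [NormedAddCommGroup E] [NormedSpace ℝ E]
  (Q : Type*) [TopologicalSpace Q] [ChartedSpace E Q] [IsManifold 𝓘(ℝ, E) ∞ Q]

/-- The cotangent bundle `T*Q`, with Mathlib's topology and smooth structure on bundles of
continuous linear maps. -/
abbrev CotangentBundle : Type _ :=
  TotalSpace (E →L[ℝ] ℝ) (fun q : Q ↦ TangentSpace 𝓘(ℝ, E) q →L[ℝ] Bundle.Trivial Q ℝ q)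

variable (E) in
/-- The model with corners of the cotangent bundle. -/
abbrev cotangentModel : ModelWithCorners ℝ (E × (E →L[ℝ] ℝ)) (ModelProd E (E →L[ℝ] ℝ)) :=
  𝓘(ℝ, E).prod 𝓘(ℝ, E →L[ℝ] ℝ)

variable {Q}

/-- The canonical projection `π_Q : T*Q → Q`. -/
def cotangentProj (p : CotangentBundle (E := E) Q) : Q := p.proj

/-- A `1`-form `γ` on `Q`, seen as a map `Q → T*Q`. -/
def toCotangent (γ : ∀ q : Q, TangentSpace 𝓘(ℝ, E) q →L[ℝ] ℝ) (q : Q) :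
    CotangentBundle (E := E) Q :=
  ⟨q, γ q⟩

/-- The Liouville `1`-form `θ = p_A dq^A` on `T*Q`: `θ_p(v) = p(Tπ_Q(v))`. -/
def liouvilleForm (p : CotangentBundle (E := E) Q) :
    TangentSpace (cotangentModel E) p →L[ℝ] ℝ :=
  ContinuousLinearMap.comp (p.snd : TangentSpace 𝓘(ℝ, E) p.proj →L[ℝ] ℝ)
    (mfderiv (cotangentModel E) 𝓘(ℝ, E) cotangentProj p)

/-- The canonical symplectic form `ω_Q = -dθ = dq^A ∧ dp_A` on `T*Q`. -/
def canonicalForm (p : CotangentBundle (E := E) Q)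
    (u v : TangentSpace (cotangentModel E) p) : ℝ :=
  -extDerivOneForm (cotangentModel E) (liouvilleForm (E := E) (Q := Q)) p u v

variable (L : TangentBundle 𝓘(ℝ, E) Q → ℝ)

/-- The Legendre mapping `FL : TQ → T*Q`, the derivative of `L` along the fibres:
`FL(v)(w) = d/dt L(v + t w)` at `t = 0`. -/
def legendre (v : TangentBundle 𝓘(ℝ, E) Q) : CotangentBundle (E := E) Q :=
  ⟨v.proj, fderiv ℝ (fun w : E ↦ L ⟨v.proj, w⟩) v.snd⟩

/-- The energy `E_L(v) = FL(v)(v) - L(v)`. -/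
def energy (v : TangentBundle 𝓘(ℝ, E) Q) : ℝ :=
  (legendre L v).snd v.snd - L v

/-- `L` is almost regular: `FL(TQ)` is a submanifold of `T*Q`, and `FL : TQ → FL(TQ)` is a
submersion with connected fibres. -/
structure IsAlmostRegular : Prop where
  isEmbeddedSubmanifold : IsEmbeddedSubmanifold (cotangentModel E) (range (legendre L))
  submersion : IsSurjectiveSubmersion 𝓘(ℝ, E).tangent (cotangentModel E) (legendre L)
    univ (range (legendre L))
  connected_fibres : ∀ p ∈ range (legendre L), IsConnected (legendre L ⁻¹' {p})

open Classical in
/-- The function `h_1` on `M_1 = FL(TQ)` onto which the energy projects: `h_1(p)` is the value of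
`E_L` at a point of the fibre of `FL` over `p`. (When `L` is almost regular, `E_L` is constant on
these fibres. Outside `M_1` the value `0` is a dummy.) -/
def constrainedHamiltonian (p : CotangentBundle (E := E) Q) : ℝ :=
  if hp : ∃ v, legendre L v = p then energy L hp.choose else 0

/-- The tangent vector `x` at `p` solves `i_x ω_1 = dh_1` at the point `p` of `M_1 = FL(TQ)`.
Here `ω_1` is the pullback of `ω_Q` to `M_1`, so the equation is tested on `T_p M_1`; there the
derivative of `h_1` within `M_1` does not depend on choices. -/
def SolvesAt (p : CotangentBundle (E := E) Q) (x : TangentSpace (cotangentModel E) p) : Prop :=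
  ∀ y ∈ tangentTo (cotangentModel E) (range (legendre L)) p,
    canonicalForm p x y =
      mfderivWithin (cotangentModel E) 𝓘(ℝ, ℝ) (constrainedHamiltonian L)
        (range (legendre L)) p y

/-- The constraint algorithm; `constraintSet L r` is `M_{r+1}`. It starts from `M_1 = FL(TQ)`, and
`M_{l+1}` is the set of the points `p` of `M_l` at which some vector of `T_p M_l` solves
`i_x ω_1 = dh_1`. -/
def constraintSet : ℕ → Set (CotangentBundle (E := E) Q)
  | 0 => range (legendre L)
  | r + 1 => {p | p ∈ constraintSet r ∧
      ∃ x ∈ tangentTo (cotangentModel E) (constraintSet r) p, SolvesAt L p x}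

/-- The projection of `M_{r+1}` to `Q`. -/
def baseSet (r : ℕ) : Set Q := cotangentProj '' constraintSet L r

/-- The vector field `X` is a solution of `i_X ω_1 = dh_1` on the submanifold `S` of `M_1`: it is
smooth along `S`, tangent to `S`, and solves the equation at all points of `S`. -/
structure IsSolutionOn (S : Set (CotangentBundle (E := E) Q))
    (X : ∀ p : CotangentBundle (E := E) Q, TangentSpace (cotangentModel E) p) : Prop where
  contMDiffOn : ContMDiffOn (cotangentModel E) (cotangentModel E).tangent ∞
    (fun p ↦ (⟨p, X p⟩ : TangentBundle (cotangentModel E) (CotangentBundle (E := E) Q))) S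
  tangent : ∀ p ∈ S, X p ∈ tangentTo (cotangentModel E) S p
  solves : ∀ p ∈ S, SolvesAt L p (X p)

/-- The vector field `X^γ = Tπ ∘ X ∘ γ`. -/
def reducedField (γ : ∀ q : Q, TangentSpace 𝓘(ℝ, E) q →L[ℝ] ℝ)
    (X : ∀ p : CotangentBundle (E := E) Q, TangentSpace (cotangentModel E) p) (q : Q) :
    TangentSpace 𝓘(ℝ, E) q :=
  mfderiv (cotangentModel E) 𝓘(ℝ, E) cotangentProj (toCotangent γ q) (X (toCotangent γ q))

/-- `γ` is a closed (smooth) `1`-form on `Q`. -/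
structure IsClosedOneForm (γ : ∀ q : Q, TangentSpace 𝓘(ℝ, E) q →L[ℝ] ℝ) : Prop where
  contMDiff : ContMDiff 𝓘(ℝ, E) (cotangentModel E) ∞ (toCotangent γ)
  closed : ∀ (q : Q) (u v : TangentSpace 𝓘(ℝ, E) q), extDerivOneForm 𝓘(ℝ, E) γ q u v = 0

end Lagrangian

end HamiltonJacobi

end

/-! The equivalence holds point by point. Fix `q` in `Q_f` and put `p = γ(q)`, `x = X(p)`. Since
`γ(Q) ⊂ M_1`, every `Tγ(u)` with `u ∈ T_qQ` is tangent to `M_1` and may be inserted in the equation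
for `X`: `d(h_1 ∘ γ)(u) = ω(x, Tγ(u))`. Closedness of `γ` means that `γ(Q)` is isotropic, so the
right side equals `ω(x - Tγ(Tπ x), Tγ(u))`. The vector `x - Tγ(Tπ x)` is vertical, and a vertical
vector pairs with `Tγ(u)` as a covector with `u`, up to sign. Hence the expression vanishes for all
`u` exactly when `x = Tγ(Tπ x)`. In canonical coordinates (`canonicalForm_apply`,
`mfderiv_toCotangent`) this reads `d(h_1 ∘ γ) = D x₁ - x₂`, where `D` is the derivative of the
coefficients of `γ`, symmetric by closedness.

The chain rule for `h_1 ∘ γ` requires `h_1`, defined by choosing points in fibres, to be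
differentiable along `M_1`. The energy is constant on the fibres of `FL`, because they are connected
and locally joined by curves along which `E_L` has derivative zero (`IsAlmostRegular.energy_eq`). So
`h_1 = E_L ∘ s` on `M_1` near a given point, for a local section `s` of `FL`. -/

noncomputable section

namespace HamiltonJacobi

/-! ### Submersions onto embedded submanifolds: local sections and curves in fibres -/

section Submersion

/-- A `C^∞` submersion between finite-dimensional spaces is locally a projection: its completion
to a local diffeomorphism has a local inverse `κ`. -/
theorem exists_local_straightening {E F : Type*} [NormedAddCommGroup E] [NormedSpace ℝ E]
    [FiniteDimensional ℝ E] [NormedAddCommGroup F] [NormedSpace ℝ F] [FiniteDimensional ℝ F]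
    {g : E → F} {x₀ : E} (hg : ContDiffAt ℝ ∞ g x₀)
    (hsurj : Function.Surjective (fderiv ℝ g x₀)) :
    ∃ (K : Submodule ℝ E) (pr : E →L[ℝ] K) (κ : F × K → E),
      ContDiffAt ℝ 1 κ (g x₀, pr x₀) ∧ κ (g x₀, pr x₀) = x₀ ∧
      (∀ᶠ z in 𝓝 (g x₀, pr x₀), g (κ z) = z.1) ∧ ∀ᶠ x in 𝓝 x₀, κ (g x, pr x) = x := by
  set A := fderiv ℝ g x₀ with hA
  have hA' : A.range = ⊤ := LinearMap.range_eq_top.2 hsurj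
  obtain ⟨pr, hpr⟩ := Submodule.ClosedComplemented.of_finiteDimensional (A.ker)
  have hpr' : pr.range = ⊤ := LinearMap.range_eq_top.2 fun y ↦ ⟨y, hpr y⟩
  have hc : IsCompl A.ker pr.ker := LinearMap.isCompl_of_proj hpr
  have : CompleteSpace E := FiniteDimensional.complete ℝ E
  have : CompleteSpace F := FiniteDimensional.complete ℝ F
  have : CompleteSpace A.ker := FiniteDimensional.complete ℝ _
  -- `(A, pr)` is bijective: `A` is onto, and `pr` is the identity on its kernel. The inverse
  -- function theorem then applies to `x ↦ (g x, pr x)`.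
  set D : E ≃L[ℝ] F × A.ker := A.equivProdOfSurjectiveOfIsCompl pr hA' hpr' hc with hD
  have hgd : HasFDerivAt g A x₀ := (hg.differentiableAt (by simp)).hasFDerivAt
  have hk : ContDiffAt ℝ 1 (fun x ↦ (g x, pr x)) x₀ :=
    (hg.of_le (by simp)).prodMk pr.contDiff.contDiffAt
  have hkd : HasFDerivAt (fun x ↦ (g x, pr x)) (D : E →L[ℝ] F × A.ker) x₀ :=
    hgd.prodMk pr.hasFDerivAt
  have hstrict : HasStrictFDerivAt (fun x ↦ (g x, pr x)) (D : E →L[ℝ] F × A.ker) x₀ :=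
    hk.hasStrictFDerivAt' hkd (by simp)
  refine ⟨A.ker, pr, hk.localInverse hkd (by simp), hk.to_localInverse hkd (by simp),
    hk.localInverse_apply_image hkd (by simp), ?_, ?_⟩
  · exact hstrict.eventually_right_inverse.mono fun z hz ↦ congrArg Prod.fst hz
  · exact hstrict.eventually_left_inverse

variable {E : Type*} [NormedAddCommGroup E] [NormedSpace ℝ E]
  {H : Type*} [TopologicalSpace H] {I : ModelWithCorners ℝ E H}
  {M : Type*} [TopologicalSpace M] [ChartedSpace H M]
  {E' : Type*} [NormedAddCommGroup E'] [NormedSpace ℝ E']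
  {H' : Type*} [TopologicalSpace H'] {J : ModelWithCorners ℝ E' H'}
  {N : Type*} [TopologicalSpace N] [ChartedSpace H' N]

/-- The velocity is described only through its action on functions, so that the equality `c 0 = p`
forces no transport between tangent spaces. -/
theorem exists_mem_tangentTo_of_curve {S : Set M} {p : M} {c : ℝ → M}
    (hc : ContMDiffAt 𝓘(ℝ, ℝ) I ∞ c 0) (hcS : ∀ᶠ t in 𝓝 (0 : ℝ), c t ∈ S) (hp : c 0 = p) :
    ∃ y ∈ tangentTo I S p, ∀ g : M → E', MDifferentiableAt I 𝓘(ℝ, E') g p →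
      mfderiv I 𝓘(ℝ, E') g p y = deriv (g ∘ c) 0 := by
  subst hp
  refine ⟨mfderiv 𝓘(ℝ, ℝ) I c 0 (1 : ℝ), ⟨c, hc, hcS, rfl⟩, fun g hg ↦ ?_⟩
  rw [← fderiv_apply_one_eq_deriv, ← mfderiv_eq_fderiv,
    mfderiv_comp 0 hg (hc.mdifferentiableAt (by simp))]
  rfl

/-- In suitable coordinates on the target, a surjective submersion onto a submanifold is a map to
a linear subspace with surjective derivative. -/
theorem IsSurjectiveSubmersion.exists_coordinates [I.Boundaryless] [J.Boundaryless]
    [IsManifold I ∞ M] [IsManifold J ∞ N] [FiniteDimensional ℝ E] [FiniteDimensional ℝ E']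
    {F : M → N} {S : Set N} (hS : IsEmbeddedSubmanifold J S)
    (hF : IsSurjectiveSubmersion I J F univ S) (v : M) :
    ∃ (W : Submodule ℝ E') (g : E → W) (ψ : N → W) (ψ' : W → N),
      ContDiffAt ℝ ∞ g (extChartAt I v v) ∧
      Function.Surjective (fderiv ℝ g (extChartAt I v v)) ∧
      MDifferentiableAt J 𝓘(ℝ, W) ψ (F v) ∧ ψ (F v) = g (extChartAt I v v) ∧
      (∀ᶠ x in 𝓝 v, ψ (F x) = g (extChartAt I v x)) ∧
      (∀ᶠ x in 𝓝 (extChartAt I v v), F ((extChartAt I v).symm x) = ψ' (g x)) ∧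
      ∀ᶠ p in 𝓝[S] (F v), ψ' (ψ p) = p := by
  obtain ⟨φ, hφ, hv, W, hW⟩ := hS (F v) (hF.mapsTo (mem_univ v))
  have hFS : ∀ x, F x ∈ S := fun x ↦ hF.mapsTo (mem_univ x)
  -- Following the slice chart by a projection onto `W` gives a `W`-valued map defined off `S` too;
  -- on `S` the projection changes nothing.
  obtain ⟨P, hP⟩ := Submodule.ClosedComplemented.of_finiteDimensional W
  have hcφ : ContMDiffOn J 𝓘(ℝ, E') ∞ (φ.extend J) φ.source := φ.contMDiffOn_extend hφ
  have hcφv : ContMDiffAt J 𝓘(ℝ, E') ∞ (φ.extend J) (F v) :=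
    hcφ.contMDiffAt (φ.open_source.mem_nhds hv)
  have hF1 : ContMDiffAt I J ∞ F ((extChartAt I v).symm (extChartAt I v v)) := hF.contMDiff _
  have hcs : ContMDiffAt 𝓘(ℝ, E) I ∞ (extChartAt I v).symm (extChartAt I v v) :=
    (contMDiffOn_extChartAt_symm v).contMDiffAt (extChartAt_target_mem_nhds v)
  have hsv : (extChartAt I v).symm (extChartAt I v v) = v := extChartAt_to_inv v
  have hG : ContMDiffAt 𝓘(ℝ, E) 𝓘(ℝ, E') ∞
      (fun x ↦ φ.extend J (F ((extChartAt I v).symm x))) (extChartAt I v v) := by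
    refine ContMDiffAt.comp (g := φ.extend J) _ ?_ (hF1.comp _ hcs)
    simpa [hsv] using hcφv
  set G : E → E' := fun x ↦ φ.extend J (F ((extChartAt I v).symm x)) with hGdef
  have hG' := hG.contDiffAt
  have hP1 : ∀ y ∈ S, y ∈ φ.source → (P (φ.extend J y) : E') = φ.extend J y := fun y hy hy' ↦ by
    have : φ.extend J y ∈ W := (hW y hy').1 hy
    exact congrArg Subtype.val (hP ⟨_, this⟩)
  have hsrc : ∀ᶠ x in 𝓝 (extChartAt I v v), F ((extChartAt I v).symm x) ∈ φ.source := by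
    have : ContinuousAt (fun x ↦ F ((extChartAt I v).symm x)) (extChartAt I v v) :=
      (hF1.comp _ hcs).continuousAt
    refine this.eventually_mem (φ.open_source.mem_nhds ?_)
    simpa [hsv] using hv
  refine ⟨W, fun x ↦ P (G x), fun y ↦ P (φ.extend J y), fun w ↦ (φ.extend J).symm w,
    P.contDiff.contDiffAt.comp _ hG', ?_, ?_, by simp [hGdef], ?_, ?_, ?_⟩
  · intro w
    -- The straight line in direction `w` in the slice chart stays in `S`. Its velocity is therefore
    -- tangent to `S` and lifts through `F`; the lift, read in the chart at `v`, is the required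
    -- preimage of `w`.
    set c : ℝ → N := fun t ↦ (φ.extend J).symm (φ.extend J (F v) + t • (w : E')) with hc
    have hc0 : c 0 = F v := by simp [hc, hv]
    have htv : (φ.extend J).target ∈ 𝓝 (φ.extend J (F v)) :=
      φ.isOpen_extend_target.mem_nhds ((φ.extend J).map_source (by simpa using hv))
    have htgt : ∀ᶠ t in 𝓝 (0 : ℝ), φ.extend J (F v) + t • (w : E') ∈ (φ.extend J).target := by
      have h1 : ContinuousAt (fun t : ℝ ↦ φ.extend J (F v) + t • (w : E')) 0 := by fun_prop
      refine h1.eventually_mem ?_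
      simpa using htv
    have hcc : ContMDiffAt 𝓘(ℝ, ℝ) J ∞ c 0 := by
      have h1 : ContMDiffAt 𝓘(ℝ, ℝ) 𝓘(ℝ, E') ∞
          (fun t : ℝ ↦ φ.extend J (F v) + t • (w : E')) 0 := by
        apply ContDiffAt.contMDiffAt
        fun_prop
      refine ContMDiffAt.comp (g := (φ.extend J).symm) _ ?_ h1
      have h2 := contMDiffOn_extend_symm (I := J) hφ
      rw [show J '' φ.target = (φ.extend J).target from (φ.extend_target' (I := J)).symm] at h2
      refine h2.contMDiffAt ?_
      simpa using htv
    have hcS : ∀ᶠ t in 𝓝 (0 : ℝ), c t ∈ S := by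
      filter_upwards [htgt] with t ht
      have h1 := (φ.extend J).map_target ht
      rw [φ.extend_source] at h1
      refine (hW _ h1).2 ?_
      have h2 : J (φ (c t)) = _ := (φ.extend J).right_inv ht
      rw [h2]
      exact W.add_mem ((hW _ hv).1 (hFS v)) (W.smul_mem _ w.2)
    obtain ⟨y, hy, hyg⟩ := exists_mem_tangentTo_of_curve (E' := E') hcc hcS hc0
    obtain ⟨z, -, hz⟩ := hF.surj_tangent v (mem_univ v) hy
    have hMφ : MDifferentiableAt J 𝓘(ℝ, E') (φ.extend J) (F v) :=
      hcφv.mdifferentiableAt (by simp)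
    have hMF : MDifferentiableAt I J F v := (hF.contMDiff v).mdifferentiableAt (by simp)
    have h2 : deriv (φ.extend J ∘ c) 0 = w := by
      have h3 : φ.extend J ∘ c =ᶠ[𝓝 0] fun t ↦ φ.extend J (F v) + t • (w : E') := by
        filter_upwards [htgt] with t ht using (φ.extend J).right_inv ht
      have h4 : HasDerivAt (fun t : ℝ ↦ φ.extend J (F v) + t • (w : E')) (w : E') 0 := by
        simpa using ((hasDerivAt_id (0 : ℝ)).smul_const (w : E')).const_add (φ.extend J (F v))
      rw [h3.deriv_eq, h4.deriv]
    have hext : MDifferentiableAt I 𝓘(ℝ, E) (extChartAt I v) v :=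
      mdifferentiableAt_extChartAt (mem_chart_source H v)
    have hGd : MDifferentiableAt 𝓘(ℝ, E) 𝓘(ℝ, E') G (extChartAt I v v) :=
      hG.mdifferentiableAt (by simp)
    have h5 : φ.extend J ∘ F =ᶠ[𝓝 v] G ∘ extChartAt I v := by
      filter_upwards [(extChartAt_source_mem_nhds (I := I) v)] with x hx
      simp only [Function.comp, hGdef]
      rw [(extChartAt I v).left_inv hx]
    have h6 := h5.mfderiv_eq (I := I) (I' := 𝓘(ℝ, E'))
    rw [mfderiv_comp v hMφ hMF, mfderiv_comp v hGd hext] at h6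
    have h7 := DFunLike.congr_fun h6 z
    refine ⟨mfderiv I 𝓘(ℝ, E) (extChartAt I v) v z, ?_⟩
    have h8 : fderiv ℝ (fun x ↦ P (G x)) (extChartAt I v v) =
        P.comp (fderiv ℝ G (extChartAt I v v)) :=
      (P.hasFDerivAt.comp _ (hG'.differentiableAt (by simp)).hasFDerivAt).fderiv
    refine (DFunLike.congr_fun h8 _).trans ?_
    have h9 : fderiv ℝ G (extChartAt I v v) (mfderiv I 𝓘(ℝ, E) (extChartAt I v) v z) = w := by
      rw [← mfderiv_eq_fderiv]
      refine h7.symm.trans (Eq.trans ?_ ((hyg _ hMφ).trans h2))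
      exact congrArg (mfderiv J 𝓘(ℝ, E') (φ.extend J) (F v)) hz
    exact (congrArg P h9).trans (hP w)
  · exact (P.contDiff.contMDiff.contMDiffAt.comp _ hcφv).mdifferentiableAt (by simp)
  · filter_upwards [(extChartAt_source_mem_nhds (I := I) v)] with x hx
    simp only [hGdef]
    rw [(extChartAt I v).left_inv hx]
  · filter_upwards [hsrc] with x hx
    simp only [hGdef]
    rw [hP1 _ (hFS _) hx, φ.extend_left_inv hx]
  · filter_upwards [self_mem_nhdsWithin, nhdsWithin_le_nhds (φ.open_source.mem_nhds hv)] with y hy hy'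
    rw [hP1 _ hy hy', φ.extend_left_inv hy']

/-- In straightened coordinates `F` is a projection, and a section is obtained by freezing the
complementary coordinate at its value `pr x₀`. -/
theorem IsSurjectiveSubmersion.exists_local_section [I.Boundaryless] [J.Boundaryless]
    [IsManifold I ∞ M] [IsManifold J ∞ N] [FiniteDimensional ℝ E] [FiniteDimensional ℝ E']
    {F : M → N} {S : Set N} (hS : IsEmbeddedSubmanifold J S)
    (hF : IsSurjectiveSubmersion I J F univ S) (v : M) :
    ∃ s : N → M, MDifferentiableAt J I s (F v) ∧ s (F v) = v ∧
      ∀ᶠ p in 𝓝[S] (F v), F (s p) = p := by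
  obtain ⟨W, g, ψ, ψ', hg, hg', hψ, hψv, -, hψ', hinv⟩ := hF.exists_coordinates hS v
  obtain ⟨K, pr, κ, hκ, hκ0, hκ1, -⟩ := exists_local_straightening hg hg'
  set x₀ := extChartAt I v v with hx₀
  have hlift : MDifferentiableAt J 𝓘(ℝ, E) (fun p ↦ κ (ψ p, pr x₀)) (F v) := by
    have h1 : MDifferentiableAt J 𝓘(ℝ, W × K) (fun p ↦ (ψ p, pr x₀)) (F v) :=
      hψ.prodMk_space mdifferentiableAt_const
    refine MDifferentiableAt.comp (g := κ) _ ?_ h1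
    rw [hψv]
    exact (hκ.differentiableAt (by simp)).mdifferentiableAt
  have hc : Filter.Tendsto (fun p ↦ (ψ p, pr x₀)) (𝓝 (F v)) (𝓝 (g x₀, pr x₀)) := by
    rw [← hψv]
    exact hψ.continuousAt.prodMk continuousAt_const
  refine ⟨fun p ↦ (extChartAt I v).symm (κ (ψ p, pr x₀)), ?_, ?_, ?_⟩
  · refine MDifferentiableAt.comp (g := (extChartAt I v).symm) _ ?_ hlift
    rw [hψv, hκ0]
    exact ((contMDiffOn_extChartAt_symm (n := ∞) v).contMDiffAt
      (extChartAt_target_mem_nhds v)).mdifferentiableAt (by simp)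
  · simp only [hψv, hκ0]
    exact extChartAt_to_inv v
  · have h1 := hc.eventually hκ1
    have h2 : ∀ᶠ z in 𝓝 (g x₀, pr x₀), F ((extChartAt I v).symm (κ z)) = ψ' (g (κ z)) :=
      hκ.continuousAt.eventually (by rw [hκ0]; exact hψ')
    filter_upwards [hinv, nhdsWithin_le_nhds h1, nhdsWithin_le_nhds (hc.eventually h2)]
      with p hp hp1 hp2
    rw [hp2, hp1, hp]

/-- The fibres of a submersion are locally connected by differentiable curves. -/
theorem IsSurjectiveSubmersion.exists_curve_in_fibre [I.Boundaryless] [J.Boundaryless]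
    [IsManifold I ∞ M] [IsManifold J ∞ N] [FiniteDimensional ℝ E] [FiniteDimensional ℝ E']
    {F : M → N} {S : Set N} (hS : IsEmbeddedSubmanifold J S)
    (hF : IsSurjectiveSubmersion I J F univ S) (v : M) :
    ∀ᶠ v' in 𝓝 v, F v' = F v → ∃ c : ℝ → M, c 0 = v ∧ c 1 = v' ∧
      ∀ t ∈ Ioo (-1 : ℝ) 2, MDifferentiableAt 𝓘(ℝ, ℝ) I c t ∧ F (c t) = F v := by
  obtain ⟨W, g, ψ, ψ', hg, hg', -, hψv, hψF, hψ', -⟩ := hF.exists_coordinates hS v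
  obtain ⟨K, pr, κ, hκ, hκ0, hκ1, hκ2⟩ := exists_local_straightening hg hg'
  have hxv : (extChartAt I v).symm (extChartAt I v v) = v := extChartAt_to_inv v
  have hxc : ContinuousAt (extChartAt I v) v := continuousAt_extChartAt v
  set x₀ := extChartAt I v v with hx₀
  have h2 : ∀ᶠ z in 𝓝 (g x₀, pr x₀), F ((extChartAt I v).symm (κ z)) = ψ' (g (κ z)) :=
    hκ.continuousAt.eventually (by rw [hκ0]; exact hψ')
  have h3 : ∀ᶠ z in 𝓝 (g x₀, pr x₀), (extChartAt I v).target ∈ 𝓝 (κ z) := by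
    refine hκ.continuousAt.eventually (p := fun x ↦ (extChartAt I v).target ∈ 𝓝 x) ?_
    rw [hκ0]
    exact eventually_mem_nhds_iff.2 (extChartAt_target_mem_nhds v)
  have hFv : ψ' (g x₀) = F v := by rw [← hψ'.self_of_nhds, hxv]
  obtain ⟨r, hr, hball⟩ := Metric.eventually_nhds_iff_ball.1
    (((hκ.eventually (by simp)).and hκ1).and (h2.and h3))
  -- Radius `r / 2` because the segment below is followed for `|t| ≤ 2`, slightly beyond `[0, 1]`,
  -- so that the curve is differentiable at both endpoints.
  have h4 : ∀ᶠ v' in 𝓝 v, dist (pr (extChartAt I v v')) (pr x₀) < r / 2 :=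
    (pr.continuous.continuousAt.comp hxc).eventually
      (Metric.ball_mem_nhds (pr x₀) (half_pos hr))
  filter_upwards [h4, hxc.eventually hκ2, hψF, extChartAt_source_mem_nhds (I := I) v]
    with v' hv1 hv2 hv3 hv4 hv5
  set x' := extChartAt I v v' with hx'
  have hgx : g x' = g x₀ := by rw [← hv3, hv5, hψv]
  -- A segment in the complementary coordinate, with the value of `g` fixed: its image under `κ`
  -- stays in the fibre.
  set z : ℝ → W × K := fun t ↦ (g x₀, pr x₀ + t • (pr x' - pr x₀)) with hz
  have hzb : ∀ t ∈ Ioo (-1 : ℝ) 2, z t ∈ Metric.ball (g x₀, pr x₀) r := by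
    intro t ht
    rw [Metric.mem_ball, Prod.dist_eq]
    simp only [hz, dist_self, dist_self_add_left]
    rw [norm_smul, max_eq_right (by positivity)]
    rw [dist_eq_norm] at hv1
    have h5 : ‖t‖ ≤ 2 := by
      rw [Real.norm_eq_abs, abs_le]
      constructor <;> linarith [ht.1, ht.2]
    calc ‖t‖ * ‖pr x' - pr x₀‖ ≤ 2 * ‖pr x' - pr x₀‖ := by gcongr
      _ < r := by linarith
  refine ⟨fun t ↦ (extChartAt I v).symm (κ (z t)), ?_, ?_, fun t ht ↦ ?_⟩
  · simp only [hz, zero_smul, add_zero, hκ0, hxv]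
  · simp only [hz, one_smul, add_sub_cancel]
    rw [← hgx, hv2, (extChartAt I v).left_inv hv4]
  · obtain ⟨⟨hb1, hb2⟩, hb3, hb4⟩ := hball _ (hzb t ht)
    refine ⟨?_, ?_⟩
    · have hzd : DifferentiableAt ℝ z t := by
        simp only [hz]
        fun_prop
      have hd : DifferentiableAt ℝ (fun t ↦ κ (z t)) t :=
        (hb1.differentiableAt (by simp)).comp t hzd
      refine MDifferentiableAt.comp (g := (extChartAt I v).symm) _ ?_ hd.mdifferentiableAt
      exact ((contMDiffOn_extChartAt_symm (n := ∞) v).contMDiffAt hb4).mdifferentiableAt (by simp)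
    · simp only
      rw [hb3, hb2, ← hFv]

end Submersion

/-! ### The energy along the fibres of `FL`, and differentiability of `h_1` -/

section Energy

variable {E : Type*} [NormedAddCommGroup E] [NormedSpace ℝ E]
  {Q : Type*} [TopologicalSpace Q] [ChartedSpace E Q]

theorem tangentBundle_eq_mk {v : TangentBundle 𝓘(ℝ, E) Q} {q : Q} (h : v.proj = q) :
    v = ⟨q, (show E from v.snd)⟩ := by
  subst h
  rfl

variable [IsManifold 𝓘(ℝ, E) ∞ Q] {L : TangentBundle 𝓘(ℝ, E) Q → ℝ}

theorem mdifferentiable_energy (hL : ContMDiff 𝓘(ℝ, E).tangent 𝓘(ℝ, ℝ) ∞ L)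
    (hF : ContMDiff 𝓘(ℝ, E).tangent (cotangentModel E) ∞ (legendre L)) :
    MDifferentiable 𝓘(ℝ, E).tangent 𝓘(ℝ, ℝ) (energy L) := by
  have h1 : ContMDiff 𝓘(ℝ, E).tangent (𝓘(ℝ, E).prod 𝓘(ℝ, ℝ)) ∞
      (fun v : TangentBundle 𝓘(ℝ, E) Q ↦
        TotalSpace.mk' ℝ (E := Bundle.Trivial Q ℝ) v.proj ((legendre L v).snd v.snd)) :=
    ContMDiff.clm_bundle_apply (F₁ := E) (F₂ := ℝ) (E₁ := fun q : Q ↦ TangentSpace 𝓘(ℝ, E) q)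
      (E₂ := Bundle.Trivial Q ℝ) (b := fun v : TangentBundle 𝓘(ℝ, E) Q ↦ v.proj)
      (ϕ := fun v ↦ (legendre L v).snd) (v := fun v ↦ v.snd) hF contMDiff_id
  have h2 : ContMDiff 𝓘(ℝ, E).tangent 𝓘(ℝ, ℝ) ∞
      (fun v : TangentBundle 𝓘(ℝ, E) Q ↦ (legendre L v).snd v.snd) :=
    fun v ↦ ((contMDiffAt_totalSpace).1 (h1 v)).2
  exact (h2.sub hL).mdifferentiable (by simp)

theorem trivializationAt_tangentSpace_self (q : Q) (w : TangentSpace 𝓘(ℝ, E) q) :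
    (trivializationAt E (TangentSpace 𝓘(ℝ, E)) q ⟨q, w⟩).2 = w := by
  have : IsManifold 𝓘(ℝ, E) 1 Q := IsManifold.of_le (n := ∞) (by simp)
  have hq : q ∈ (trivializationAt E (TangentSpace 𝓘(ℝ, E)) q).baseSet :=
    FiberBundle.mem_baseSet_trivializationAt' q
  rw [← Trivialization.continuousLinearMapAt_apply_of_mem (R := ℝ) _ hq,
    TangentBundle.continuousLinearMapAt_trivializationAt (mem_chart_source E q),
    mfderiv_extChartAt_self]
  rfl

/-- The curve stays in one `T_qQ`, and the fibre derivative of `L` along it is a fixed covector `α`.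
So `E_L = α(w) - L(w)` has derivative `α(w') - α(w') = 0`. -/
theorem energy_eq_of_curve_in_fibre (hL : ContMDiff 𝓘(ℝ, E).tangent 𝓘(ℝ, ℝ) ∞ L)
    {v : TangentBundle 𝓘(ℝ, E) Q} {c : ℝ → TangentBundle 𝓘(ℝ, E) Q}
    (hc : ∀ t ∈ Ioo (-1 : ℝ) 2, MDifferentiableAt 𝓘(ℝ, ℝ) 𝓘(ℝ, E).tangent c t ∧
      legendre L (c t) = legendre L v) :
    energy L (c 0) = energy L (c 1) := by
  set q := v.proj with hq
  set α : E →L[ℝ] ℝ := fderiv ℝ (fun w : E ↦ L ⟨q, w⟩) v.snd with hα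
  set w : ℝ → E := fun t ↦ (c t).snd with hw
  have hcw : ∀ t ∈ Ioo (-1 : ℝ) 2, c t = ⟨q, w t⟩ := fun t ht ↦
    tangentBundle_eq_mk (congrArg (fun p : CotangentBundle (E := E) Q ↦ p.proj) (hc t ht).2)
  have hcα : ∀ t ∈ Ioo (-1 : ℝ) 2, fderiv ℝ (fun w : E ↦ L ⟨q, w⟩) (w t) = α := fun t ht ↦ by
    have h := (hc t ht).2
    rw [hcw t ht] at h
    exact TotalSpace.mk_injective q h
  have hnhds : ∀ t ∈ Ioo (-1 : ℝ) 2, Ioo (-1 : ℝ) 2 ∈ 𝓝 t := fun t ht ↦ isOpen_Ioo.mem_nhds ht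
  have hwd : ∀ t ∈ Ioo (-1 : ℝ) 2, DifferentiableAt ℝ w t := fun t ht ↦ by
    have h1 := ((mdifferentiableAt_totalSpace _ _).1 (hc t ht).1).2
    refine (mdifferentiableAt_iff_differentiableAt.1 h1).congr_of_eventuallyEq ?_
    filter_upwards [hnhds t ht] with s hs
    rw [hcw s hs, hcw t ht]
    exact (trivializationAt_tangentSpace_self q (w s)).symm
  have hLd : ∀ x : E, DifferentiableAt ℝ (fun w : E ↦ L ⟨q, w⟩) x := fun x ↦ by
    have h1 : MDifferentiableAt 𝓘(ℝ, E) 𝓘(ℝ, E).tangent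
        (fun w : E ↦ (⟨q, w⟩ : TangentBundle 𝓘(ℝ, E) Q)) x := by
      refine (mdifferentiableAt_totalSpace _ _).2 ⟨mdifferentiableAt_const, ?_⟩
      exact (mdifferentiableAt_id (I := 𝓘(ℝ, E)) (x := x)).congr_of_eventuallyEq
        (Filter.Eventually.of_forall fun w ↦ trivializationAt_tangentSpace_self q w)
    exact (((hL _).mdifferentiableAt (by simp)).comp x h1).differentiableAt
  have hE : ∀ t ∈ Ioo (-1 : ℝ) 2, energy L (c t) = α (w t) - L ⟨q, w t⟩ := fun t ht ↦ by
    rw [hcw t ht, ← hcα t ht]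
    rfl
  have hder : ∀ t ∈ Ioo (-1 : ℝ) 2, HasDerivAt (fun t ↦ α (w t) - L ⟨q, w t⟩) 0 t := fun t ht ↦ by
    have h1 := (hwd t ht).hasDerivAt
    have h2 := α.hasFDerivAt.comp_hasDerivAt t h1
    have h3 := (hLd (w t)).hasFDerivAt.comp_hasDerivAt t h1
    rw [hcα t ht] at h3
    have h4 := h2.sub h3
    rw [sub_self] at h4
    exact h4
  rw [hE 0 (by simp), hE 1 (by norm_num)]
  exact isOpen_Ioo.is_const_of_deriv_eq_zero isPreconnected_Ioo
    (fun t ht ↦ (hder t ht).differentiableAt.differentiableWithinAt)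
    (fun t ht ↦ (hder t ht).deriv) (by simp) (by norm_num)

variable [FiniteDimensional ℝ E]

/-- Curves in the fibres make the energy locally constant on each fibre; connectedness does the
rest. -/
theorem IsAlmostRegular.energy_eq (hL : ContMDiff 𝓘(ℝ, E).tangent 𝓘(ℝ, ℝ) ∞ L)
    (hreg : IsAlmostRegular L) {v v' : TangentBundle 𝓘(ℝ, E) Q}
    (h : legendre L v = legendre L v') : energy L v = energy L v' := by
  have hconn := (hreg.connected_fibres _ (mem_range_self v')).isPreconnected
  have := isPreconnected_iff_preconnectedSpace.1 hconn
  have hlc : IsLocallyConstant (fun x : legendre L ⁻¹' {legendre L v'} ↦ energy L x) := by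
    refine (IsLocallyConstant.iff_eventually_eq _).2 fun x ↦ ?_
    have h1 := hreg.submersion.exists_curve_in_fibre hreg.isEmbeddedSubmanifold x.1
    filter_upwards [continuous_subtype_val.continuousAt.eventually h1] with y hy
    obtain ⟨c, hc0, hc1, hc⟩ := hy (y.2.trans x.2.symm)
    rw [← hc0, ← hc1]
    exact (energy_eq_of_curve_in_fibre hL hc).symm
  exact hlc.apply_eq_of_preconnectedSpace ⟨v, h⟩ ⟨v', rfl⟩

theorem IsAlmostRegular.constrainedHamiltonian_legendre
    (hL : ContMDiff 𝓘(ℝ, E).tangent 𝓘(ℝ, ℝ) ∞ L)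
    (hreg : IsAlmostRegular L) (v : TangentBundle 𝓘(ℝ, E) Q) :
    constrainedHamiltonian L (legendre L v) = energy L v := by
  have h : ∃ v', legendre L v' = legendre L v := ⟨v, rfl⟩
  rw [constrainedHamiltonian, dif_pos h]
  exact hreg.energy_eq hL h.choose_spec

/-- Near the point, `h_1` agrees on `M_1` with `E_L ∘ s` for a local section `s` of `FL`. This rules
out the default value zero of `mfderivWithin`. -/
theorem IsAlmostRegular.mdifferentiableWithinAt_constrainedHamiltonian
    (hL : ContMDiff 𝓘(ℝ, E).tangent 𝓘(ℝ, ℝ) ∞ L) (hreg : IsAlmostRegular L)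
    {p : CotangentBundle (E := E) Q} (hp : p ∈ range (legendre L)) :
    MDifferentiableWithinAt (cotangentModel E) 𝓘(ℝ, ℝ) (constrainedHamiltonian L)
      (range (legendre L)) p := by
  obtain ⟨v, rfl⟩ := hp
  obtain ⟨s, hs, hsv, hsec⟩ :=
    hreg.submersion.exists_local_section hreg.isEmbeddedSubmanifold v
  have h1 : MDifferentiableAt (cotangentModel E) 𝓘(ℝ, ℝ) (energy L ∘ s) (legendre L v) :=
    MDifferentiableAt.comp _ (mdifferentiable_energy hL hreg.submersion.contMDiff _) hs
  have h2 : ∀ x, legendre L (s x) = x → constrainedHamiltonian L x = (energy L ∘ s) x :=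
    fun x hx ↦ by
      conv_lhs => rw [← hx]
      exact hreg.constrainedHamiltonian_legendre hL (s x)
  refine h1.mdifferentiableWithinAt.congr_of_eventuallyEq ?_ (h2 _ (by rw [hsv]))
  filter_upwards [hsec] with x hx using h2 x hx

end Energy

/-- The exterior derivative of a `1`-form whose coefficients in the chart at `p` are linear. -/
theorem extDerivOneForm_eq_of_linear {E : Type*} [NormedAddCommGroup E] [NormedSpace ℝ E]
    {H : Type*} [TopologicalSpace H] {I : ModelWithCorners ℝ E H} [I.Boundaryless]
    {M : Type*} [TopologicalSpace M] [ChartedSpace H M]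
    {θ : ∀ p : M, TangentSpace I p →L[ℝ] ℝ} {p : M} {Λ : E →L[ℝ] E →L[ℝ] ℝ}
    (h : ∀ z ∈ (extChartAt I p).target, oneFormInChart I θ p z = Λ z) (u v : E) :
    extDerivOneForm I θ p u v = Λ u v - Λ v u := by
  have h1 : oneFormInChart I θ p =ᶠ[𝓝 (extChartAt I p p)] Λ := by
    filter_upwards [extChartAt_target_mem_nhds (I := I) p] with z hz using h z hz
  have h2 : fderivWithin ℝ (oneFormInChart I θ p) (range I) (extChartAt I p p) = Λ := by
    rw [ModelWithCorners.range_eq_univ, fderivWithin_univ, h1.fderiv_eq, Λ.fderiv]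
  subst h2
  rfl

/-! ### Canonical coordinates on the cotangent bundle -/

section Coordinates

variable {E : Type*} [NormedAddCommGroup E] [NormedSpace ℝ E]
  {Q : Type*} [TopologicalSpace Q] [ChartedSpace E Q] [IsManifold 𝓘(ℝ, E) ∞ Q]

/-- These are the classical momenta `p_A = β(∂/∂q^A)`. -/
theorem trivializationAt_cotangent_snd {q₀ q : Q} (hq : q ∈ (chartAt E q₀).source)
    (β : TangentSpace 𝓘(ℝ, E) q →L[ℝ] ℝ) :
    (trivializationAt (E →L[ℝ] ℝ)
        (fun q : Q ↦ TangentSpace 𝓘(ℝ, E) q →L[ℝ] Bundle.Trivial Q ℝ q) q₀ ⟨q, β⟩).2 =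
      β.comp (mfderivWithin 𝓘(ℝ, E) 𝓘(ℝ, E) (extChartAt 𝓘(ℝ, E) q₀).symm (range 𝓘(ℝ, E))
        (extChartAt 𝓘(ℝ, E) q₀ q)) := by
  have : IsManifold 𝓘(ℝ, E) 1 Q := IsManifold.of_le (n := ∞) (by simp)
  rw [hom_trivializationAt_apply, ← TangentBundle.symmL_trivializationAt hq]
  ext u
  simp [ContinuousLinearMap.inCoordinates]
  rfl

theorem mem_extChartAt_cotangent_source {p p' : CotangentBundle (E := E) Q} :
    p' ∈ (extChartAt (cotangentModel E) p).source ↔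
      p'.proj ∈ (extChartAt 𝓘(ℝ, E) p.proj).source := by
  rw [FiberBundle.extChartAt]
  have hb : ∀ q : Q, q ∈ (trivializationAt (E →L[ℝ] ℝ)
        (fun q : Q ↦ TangentSpace 𝓘(ℝ, E) q →L[ℝ] Bundle.Trivial Q ℝ q) p.proj).baseSet ↔
      q ∈ (extChartAt 𝓘(ℝ, E) p.proj).source := by simp
  constructor
  · intro h
    exact (hb _).1 ((Trivialization.mem_source _).1 h.1)
  · intro h
    refine ⟨(Trivialization.mem_source _).2 ((hb _).2 h), ?_, mem_univ _⟩
    have h' := Trivialization.coe_fst' _ ((hb _).2 h)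
    exact h'.symm ▸ h

theorem extChartAt_cotangent_apply {p p' : CotangentBundle (E := E) Q}
    (hp : p'.proj ∈ (extChartAt 𝓘(ℝ, E) p.proj).source) :
    extChartAt (cotangentModel E) p p' = (extChartAt 𝓘(ℝ, E) p.proj p'.proj,
      ContinuousLinearMap.comp (p'.snd : TangentSpace 𝓘(ℝ, E) p'.proj →L[ℝ] ℝ)
        (mfderivWithin 𝓘(ℝ, E) 𝓘(ℝ, E) (extChartAt 𝓘(ℝ, E) p.proj).symm (range 𝓘(ℝ, E))
          (extChartAt 𝓘(ℝ, E) p.proj p'.proj))) := by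
  rw [← trivializationAt_cotangent_snd (by simpa using hp)]
  rw [FiberBundle.extChartAt]
  have h : p'.proj ∈ (trivializationAt (E →L[ℝ] ℝ)
        (fun q : Q ↦ TangentSpace 𝓘(ℝ, E) q →L[ℝ] Bundle.Trivial Q ℝ q) p.proj).baseSet := by
    simpa using hp
  refine Prod.ext ?_ rfl
  exact congrArg (extChartAt 𝓘(ℝ, E) p.proj) (Trivialization.coe_fst' _ h)

theorem cotangentProj_extChartAt_symm {p : CotangentBundle (E := E) Q}
    {z : E × (E →L[ℝ] ℝ)} (hz : z ∈ (extChartAt (cotangentModel E) p).target) :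
    z.1 ∈ (extChartAt 𝓘(ℝ, E) p.proj).target ∧
      cotangentProj ((extChartAt (cotangentModel E) p).symm z) =
        (extChartAt 𝓘(ℝ, E) p.proj).symm z.1 := by
  have h1 := (extChartAt (cotangentModel E) p).map_target hz
  rw [mem_extChartAt_cotangent_source] at h1
  have h2 := extChartAt_cotangent_apply h1
  rw [(extChartAt (cotangentModel E) p).right_inv hz] at h2
  have h3 := congrArg Prod.fst h2
  simp only at h3
  rw [h3]
  exact ⟨(extChartAt 𝓘(ℝ, E) p.proj).map_source h1,
    ((extChartAt 𝓘(ℝ, E) p.proj).left_inv h1).symm⟩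

theorem contMDiff_cotangentProj :
    ContMDiff (cotangentModel E) 𝓘(ℝ, E) ∞ (cotangentProj : CotangentBundle (E := E) Q → Q) :=
  contMDiff_proj _

theorem mfderiv_cotangentProj (p : CotangentBundle (E := E) Q) (u : E × (E →L[ℝ] ℝ)) :
    (mfderiv (cotangentModel E) 𝓘(ℝ, E) cotangentProj p :
      E × (E →L[ℝ] ℝ) →L[ℝ] E) u = u.1 := by
  have h1 : writtenInExtChartAt (cotangentModel E) 𝓘(ℝ, E) p cotangentProj
      =ᶠ[𝓝 (extChartAt (cotangentModel E) p p)] Prod.fst := by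
    filter_upwards [extChartAt_target_mem_nhds (I := cotangentModel E) p] with z hz
    obtain ⟨h2, h3⟩ := cotangentProj_extChartAt_symm hz
    simp only [writtenInExtChartAt, Function.comp, h3]
    exact (extChartAt 𝓘(ℝ, E) p.proj).right_inv h2
  have h2 : MDifferentiableAt (cotangentModel E) 𝓘(ℝ, E) cotangentProj p :=
    (contMDiff_cotangentProj p).mdifferentiableAt (by simp)
  rw [h2.mfderiv, ModelWithCorners.range_eq_univ, fderivWithin_univ, h1.fderiv_eq, fderiv_fst]
  rfl

/-- This is `θ = p_A dq^A`: in the charts `π_Q` is the first projection, and the second coordinate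
of a covector is its pullback by the inverse base chart. -/
theorem oneFormInChart_liouvilleForm (p : CotangentBundle (E := E) Q) {z : E × (E →L[ℝ] ℝ)}
    (hz : z ∈ (extChartAt (cotangentModel E) p).target) (u : E × (E →L[ℝ] ℝ)) :
    oneFormInChart (cotangentModel E) liouvilleForm p z u = z.2 u.1 := by
  obtain ⟨hz1, hz2⟩ := cotangentProj_extChartAt_symm hz
  have h0 := (extChartAt (cotangentModel E) p).map_target hz
  rw [mem_extChartAt_cotangent_source] at h0
  have h1 := extChartAt_cotangent_apply h0
  rw [(extChartAt (cotangentModel E) p).right_inv hz] at h1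
  have hΨ : MDifferentiableWithinAt 𝓘(ℝ, E × (E →L[ℝ] ℝ)) (cotangentModel E)
      (extChartAt (cotangentModel E) p).symm (range (cotangentModel E)) z :=
    mdifferentiableWithinAt_extChartAt_symm hz
  have hχ : MDifferentiableWithinAt 𝓘(ℝ, E) 𝓘(ℝ, E)
      (extChartAt 𝓘(ℝ, E) p.proj).symm (range 𝓘(ℝ, E)) z.1 :=
    mdifferentiableWithinAt_extChartAt_symm hz1
  have h2 : cotangentProj ∘ (extChartAt (cotangentModel E) p).symm
      =ᶠ[𝓝 z] (extChartAt 𝓘(ℝ, E) p.proj).symm ∘ Prod.fst := by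
    filter_upwards [(isOpen_extChartAt_target (I := cotangentModel E) p).mem_nhds hz] with z' hz'
    exact (cotangentProj_extChartAt_symm hz').2
  have hproj : MDifferentiableAt (cotangentModel E) 𝓘(ℝ, E) cotangentProj
      ((extChartAt (cotangentModel E) p).symm z) :=
    (contMDiff_cotangentProj _).mdifferentiableAt (by simp)
  have h3 := h2.mfderiv_eq (I := 𝓘(ℝ, E × (E →L[ℝ] ℝ))) (I' := 𝓘(ℝ, E))
  have hr : range (cotangentModel E) = univ := ModelWithCorners.range_eq_univ _
  have hr' : range 𝓘(ℝ, E) = univ := ModelWithCorners.range_eq_univ _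
  rw [hr, mdifferentiableWithinAt_univ] at hΨ
  rw [hr', mdifferentiableWithinAt_univ] at hχ
  have hfst : MDifferentiableAt 𝓘(ℝ, E × (E →L[ℝ] ℝ)) 𝓘(ℝ, E)
      (Prod.fst : E × (E →L[ℝ] ℝ) → E) z := differentiableAt_fst.mdifferentiableAt
  rw [mfderiv_comp z hproj hΨ, mfderiv_comp z hχ hfst, mfderiv_eq_fderiv, fderiv_fst] at h3
  have h4 := DFunLike.congr_fun (congrArg Prod.snd h1) u.1
  have h5 := congrArg Prod.fst h1
  simp only at h5
  rw [← h5, hr', mfderivWithin_univ] at h4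
  refine Eq.trans ?_ h4.symm
  have h6 := DFunLike.congr_fun h3 u
  simp only [oneFormInChart, hr, mfderivWithin_univ]
  exact congrArg ((extChartAt (cotangentModel E) p).symm z).snd h6

theorem canonicalForm_apply (p : CotangentBundle (E := E) Q) (u v : E × (E →L[ℝ] ℝ)) :
    canonicalForm p u v = v.2 u.1 - u.2 v.1 := by
  -- `Λ z w = z.2 w.1`: the coefficients of `θ` depend linearly on the point, so `dθ` is the
  -- antisymmetrization of `Λ`.
  set Λ : E × (E →L[ℝ] ℝ) →L[ℝ] E × (E →L[ℝ] ℝ) →L[ℝ] ℝ :=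
    ((ContinuousLinearMap.compL ℝ (E × (E →L[ℝ] ℝ)) E ℝ).flip
      (ContinuousLinearMap.fst ℝ E (E →L[ℝ] ℝ))).comp
      (ContinuousLinearMap.snd ℝ E (E →L[ℝ] ℝ)) with hΛ
  exact (congrArg Neg.neg (extDerivOneForm_eq_of_linear (Λ := Λ) (fun z hz ↦
    ContinuousLinearMap.ext fun w ↦ oneFormInChart_liouvilleForm p hz w) u v)).trans (neg_sub _ _)

/-- In the charts at `q` and `γ(q)` the map `γ` is the graph of its coefficient function. -/
theorem mfderiv_toCotangent {γ : ∀ q : Q, TangentSpace 𝓘(ℝ, E) q →L[ℝ] ℝ}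
    (hγ : ContMDiff 𝓘(ℝ, E) (cotangentModel E) ∞ (toCotangent γ)) (q : Q) (u : E) :
    (mfderiv 𝓘(ℝ, E) (cotangentModel E) (toCotangent γ) q : E →L[ℝ] E × (E →L[ℝ] ℝ)) u =
      (u, fderiv ℝ (oneFormInChart 𝓘(ℝ, E) γ q) (extChartAt 𝓘(ℝ, E) q q) u) := by
  have h1 : writtenInExtChartAt 𝓘(ℝ, E) (cotangentModel E) q (toCotangent γ)
      =ᶠ[𝓝 (extChartAt 𝓘(ℝ, E) q q)] fun y ↦ (y, oneFormInChart 𝓘(ℝ, E) γ q y) := by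
    filter_upwards [extChartAt_target_mem_nhds (I := 𝓘(ℝ, E)) q] with y hy
    have h2 := (extChartAt 𝓘(ℝ, E) q).map_target hy
    simp only [writtenInExtChartAt, Function.comp]
    rw [extChartAt_cotangent_apply (by exact h2)]
    simp only [toCotangent, oneFormInChart]
    rw [(extChartAt 𝓘(ℝ, E) q).right_inv hy]
    rfl
  have h2 : MDifferentiableAt 𝓘(ℝ, E) (cotangentModel E) (toCotangent γ) q :=
    (hγ q).mdifferentiableAt (by simp)
  have h3 : DifferentiableAt ℝ (writtenInExtChartAt 𝓘(ℝ, E) (cotangentModel E) q (toCotangent γ))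
      (extChartAt 𝓘(ℝ, E) q q) := by
    have := h2.differentiableWithinAt_writtenInExtChartAt
    rwa [ModelWithCorners.range_eq_univ, differentiableWithinAt_univ] at this
  have h4 : DifferentiableAt ℝ (oneFormInChart 𝓘(ℝ, E) γ q) (extChartAt 𝓘(ℝ, E) q q) :=
    (h1.differentiableAt_iff.1 h3).snd
  rw [h2.mfderiv, ModelWithCorners.range_eq_univ, fderivWithin_univ, h1.fderiv_eq]
  exact DFunLike.congr_fun ((hasFDerivAt_id _).prodMk h4.hasFDerivAt).fderiv u

end Coordinates

/-! ### The Hamilton–Jacobi equivalence at a point -/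

section HamiltonJacobiEquation

variable {E : Type*} [NormedAddCommGroup E] [NormedSpace ℝ E]
  {Q : Type*} [TopologicalSpace Q] [ChartedSpace E Q]

/-- Every tangent vector is the velocity of a smooth curve. -/
theorem exists_curve_tangentMap_eq [IsManifold 𝓘(ℝ, E) ∞ Q] (q : Q) (u : E) :
    ∃ b : ℝ → Q, ContMDiffAt 𝓘(ℝ, ℝ) 𝓘(ℝ, E) ∞ b 0 ∧
      tangentMap 𝓘(ℝ, ℝ) 𝓘(ℝ, E) b ⟨0, (1 : ℝ)⟩ = ⟨q, u⟩ := by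
  set a : ℝ → E := fun t ↦ extChartAt 𝓘(ℝ, E) q q + t • u with ha
  set b : ℝ → Q := fun t ↦ (extChartAt 𝓘(ℝ, E) q).symm (a t) with hb
  have ha0 : a 0 = extChartAt 𝓘(ℝ, E) q q := by simp [ha]
  have hb0 : b 0 = q := by
    simp only [hb, ha0]
    exact extChartAt_to_inv q
  have had : ContDiff ℝ ∞ a := by fun_prop
  have htgt := extChartAt_target_mem_nhds (I := 𝓘(ℝ, E)) q
  rw [← ha0] at htgt
  have hbs : ContMDiffAt 𝓘(ℝ, ℝ) 𝓘(ℝ, E) ∞ b 0 :=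
    ((contMDiffOn_extChartAt_symm q).contMDiffAt htgt).comp 0 had.contMDiff.contMDiffAt
  have h1 : writtenInExtChartAt 𝓘(ℝ, ℝ) 𝓘(ℝ, E) 0 b =ᶠ[𝓝 0] a := by
    filter_upwards [had.continuous.continuousAt.eventually_mem htgt] with t ht
    simp only [writtenInExtChartAt, hb0]
    exact (extChartAt 𝓘(ℝ, E) q).right_inv ht
  have h2 : HasFDerivAt a (ContinuousLinearMap.toSpanSingleton ℝ u) 0 := by
    have := ((hasDerivAt_id (0 : ℝ)).smul_const u).const_add (extChartAt 𝓘(ℝ, E) q q)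
    rw [one_smul] at this
    exact this.hasFDerivAt
  have h3 : (mfderiv 𝓘(ℝ, ℝ) 𝓘(ℝ, E) b 0 : ℝ →L[ℝ] E) =
      ContinuousLinearMap.toSpanSingleton ℝ u := by
    rw [(hbs.mdifferentiableAt (by simp)).mfderiv, ModelWithCorners.range_eq_univ,
      fderivWithin_univ]
    exact h1.fderiv_eq.trans h2.fderiv
  refine ⟨b, hbs, ?_⟩
  have h4 : (mfderiv 𝓘(ℝ, ℝ) 𝓘(ℝ, E) b 0 : ℝ →L[ℝ] E) 1 = u :=
    (DFunLike.congr_fun h3 1).trans (one_smul ℝ u)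
  -- The body of `b` mentions `q`; it is made opaque so that `q` can be replaced by `b 0`, over
  -- which the velocity lives.
  clear_value b
  subst hb0
  exact congrArg (TotalSpace.mk (b 0)) h4

variable [IsManifold 𝓘(ℝ, E) ∞ Q] {γ : ∀ q : Q, TangentSpace 𝓘(ℝ, E) q →L[ℝ] ℝ}

/-- With `S = M_1`, this makes every `Tγ(u)` an admissible test vector in `i_X ω_1 = dh_1`. -/
theorem mfderiv_toCotangent_mem_tangentTo
    (hγ : ContMDiff 𝓘(ℝ, E) (cotangentModel E) ∞ (toCotangent γ))
    {S : Set (CotangentBundle (E := E) Q)} (hS : ∀ q, toCotangent γ q ∈ S) (q : Q)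
    (u : TangentSpace 𝓘(ℝ, E) q) :
    mfderiv 𝓘(ℝ, E) (cotangentModel E) (toCotangent γ) q u ∈
      tangentTo (cotangentModel E) S (toCotangent γ q) := by
  obtain ⟨b, hb, hbu⟩ := exists_curve_tangentMap_eq (E := E) q u
  refine ⟨toCotangent γ ∘ b, (hγ _).comp 0 hb, Filter.Eventually.of_forall fun t ↦ hS _, ?_⟩
  rw [tangentMap_comp_at _ ((hγ _).mdifferentiableAt (by simp)) (hb.mdifferentiableAt (by simp)),
    hbu]
  rfl

variable [FiniteDimensional ℝ E] {L : TangentBundle 𝓘(ℝ, E) Q → ℝ}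

/-- A derivative of `h_1` within `M_1` need not be unique on the ambient tangent space. Any choice
obeys the chain rule with a map into `M_1`, and the composite is determined because `γ` is defined
on all of `Q`. -/
theorem mfderiv_constrainedHamiltonian_comp
    (hL : ContMDiff 𝓘(ℝ, E).tangent 𝓘(ℝ, ℝ) ∞ L) (hreg : IsAlmostRegular L)
    (hγ : ContMDiff 𝓘(ℝ, E) (cotangentModel E) ∞ (toCotangent γ))
    (hγ₁ : ∀ q, toCotangent γ q ∈ range (legendre L)) (q : Q) :
    mfderiv 𝓘(ℝ, E) 𝓘(ℝ, ℝ) (fun q' ↦ constrainedHamiltonian L (toCotangent γ q')) q =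
      (mfderivWithin (cotangentModel E) 𝓘(ℝ, ℝ) (constrainedHamiltonian L)
        (range (legendre L)) (toCotangent γ q)).comp
        (mfderiv 𝓘(ℝ, E) (cotangentModel E) (toCotangent γ) q) := by
  have h1 := (hreg.mdifferentiableWithinAt_constrainedHamiltonian hL (hγ₁ q)).hasMFDerivWithinAt
  have h2 := ((hγ q).mdifferentiableAt (by simp)).hasMFDerivAt.hasMFDerivWithinAt (s := univ)
  have h3 := HasMFDerivWithinAt.comp q h1 h2 fun x _ ↦ hγ₁ x
  exact (hasMFDerivWithinAt_univ.1 h3).mfderiv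

/-- At a point of the image of `γ`, a solution `x` of `i_x ω_1 = dh_1` is tangent to `γ(Q)` if and
only if `h_1 ∘ γ` is critical there. -/
theorem mfderiv_toCotangent_eq_iff
    (hL : ContMDiff 𝓘(ℝ, E).tangent 𝓘(ℝ, ℝ) ∞ L) (hreg : IsAlmostRegular L)
    (hγ : IsClosedOneForm γ) (hγ₁ : ∀ q, toCotangent γ q ∈ range (legendre L)) (q : Q)
    {X : ∀ p : CotangentBundle (E := E) Q, TangentSpace (cotangentModel E) p}
    (hX : SolvesAt L (toCotangent γ q) (X (toCotangent γ q))) :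
    mfderiv 𝓘(ℝ, E) (cotangentModel E) (toCotangent γ) q (reducedField γ X q) =
        X (toCotangent γ q) ↔
      mfderiv 𝓘(ℝ, E) 𝓘(ℝ, ℝ) (fun q' ↦ constrainedHamiltonian L (toCotangent γ q')) q = 0 := by
  obtain ⟨x, hx⟩ : ∃ x : E × (E →L[ℝ] ℝ), x = X (toCotangent γ q) := ⟨_, rfl⟩
  set D : E →L[ℝ] E →L[ℝ] ℝ :=
    fderiv ℝ (oneFormInChart 𝓘(ℝ, E) γ q) (extChartAt 𝓘(ℝ, E) q q) with hD
  -- Closedness of `γ` is the symmetry of the derivative of its coefficients.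
  have hDsymm : ∀ u v, D u v = D v u := fun u v ↦ by
    have h1 : fderivWithin ℝ (oneFormInChart 𝓘(ℝ, E) γ q) (range 𝓘(ℝ, E))
        (extChartAt 𝓘(ℝ, E) q q) = D := by
      rw [ModelWithCorners.range_eq_univ, fderivWithin_univ]
    have h2 : extDerivOneForm 𝓘(ℝ, E) γ q u v = D u v - D v u := by
      rw [← h1]
      rfl
    exact sub_eq_zero.1 (h2.symm.trans (hγ.closed q u v))
  have hred : reducedField γ X q = x.1 := by
    rw [hx]
    exact mfderiv_cotangentProj _ _
  have hleft : mfderiv 𝓘(ℝ, E) (cotangentModel E) (toCotangent γ) q (reducedField γ X q) =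
      (x.1, D x.1) := by
    rw [hred]
    exact mfderiv_toCotangent hγ.contMDiff q x.1
  -- The equation for `X` tested on `Tγ(u) = (u, D u)` gives `D u x₁ - x₂ u`; symmetry turns this
  -- into the covector `D x₁ - x₂` applied to `u`.
  have hdh : ∀ u : E, (mfderiv 𝓘(ℝ, E) 𝓘(ℝ, ℝ)
      (fun q' ↦ constrainedHamiltonian L (toCotangent γ q')) q : E →L[ℝ] ℝ) u =
        D x.1 u - x.2 u := fun u ↦ by
    rw [mfderiv_constrainedHamiltonian_comp hL hreg hγ.contMDiff hγ₁]
    have h1 := hX _ (mfderiv_toCotangent_mem_tangentTo hγ.contMDiff hγ₁ q u)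
    refine h1.symm.trans ?_
    rw [← hx, hDsymm]
    exact (congrArg (canonicalForm (toCotangent γ q) x)
      (mfderiv_toCotangent hγ.contMDiff q u)).trans (canonicalForm_apply _ _ _)
  have h0 : mfderiv 𝓘(ℝ, E) 𝓘(ℝ, ℝ)
      (fun q' ↦ constrainedHamiltonian L (toCotangent γ q')) q = 0 ↔ D x.1 = x.2 := by
    constructor
    · intro h
      ext u
      refine sub_eq_zero.1 ((hdh u).symm.trans ?_)
      rw [h]
      rfl
    · intro h
      refine ContinuousLinearMap.ext fun u ↦ (hdh u).trans ?_
      rw [h, sub_self]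
      rfl
  rw [h0, hleft, ← hx]
  exact ⟨fun h ↦ congrArg Prod.snd h, fun h ↦ Prod.ext rfl h⟩

end HamiltonJacobiEquation

end HamiltonJacobi

end

theorem mainTheorem2
    {E : Type*} [NormedAddCommGroup E] [NormedSpace ℝ E] [FiniteDimensional ℝ E]
    {Q : Type*} [TopologicalSpace Q] [T2Space Q] [SecondCountableTopology Q]
    [ChartedSpace E Q] [IsManifold 𝓘(ℝ, E) ∞ Q]
    -- an almost regular Lagrangian
    (L : TangentBundle 𝓘(ℝ, E) Q → ℝ)
    (hL : ContMDiff 𝓘(ℝ, E).tangent 𝓘(ℝ, ℝ) ∞ L)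
    (hreg : HamiltonJacobi.IsAlmostRegular L)
    -- the algorithm stabilizes; the final constraint submanifold is `constraintSet L f`
    (f : ℕ)
    (hf : HamiltonJacobi.constraintSet L (f + 1) = HamiltonJacobi.constraintSet L f)
    (hM : ∀ r ≤ f, HamiltonJacobi.IsEmbeddedSubmanifold (HamiltonJacobi.cotangentModel E)
      (HamiltonJacobi.constraintSet L r))
    (hQ : ∀ r ≤ f, HamiltonJacobi.IsEmbeddedSubmanifold 𝓘(ℝ, E) (HamiltonJacobi.baseSet L r))
    -- the projections of the constraint submanifolds to their images in `Q` are fibrations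
    (hπ : ∀ r ≤ f, HamiltonJacobi.IsSurjectiveSubmersion (HamiltonJacobi.cotangentModel E)
      𝓘(ℝ, E) HamiltonJacobi.cotangentProj
      (HamiltonJacobi.constraintSet L r) (HamiltonJacobi.baseSet L r))
    -- the closed `1`-form `γ`
    (γ : ∀ q : Q, TangentSpace 𝓘(ℝ, E) q →L[ℝ] ℝ)
    (hγ : HamiltonJacobi.IsClosedOneForm γ)
    (hγ₁ : ∀ q : Q, HamiltonJacobi.toCotangent γ q ∈ HamiltonJacobi.constraintSet L 0)
    (hγf : ∀ q ∈ HamiltonJacobi.baseSet L f,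
      HamiltonJacobi.toCotangent γ q ∈ HamiltonJacobi.constraintSet L f)
    -- a solution `X` on the final constraint submanifold
    (X : ∀ p : HamiltonJacobi.CotangentBundle (E := E) Q,
      TangentSpace (HamiltonJacobi.cotangentModel E) p)
    (hX : HamiltonJacobi.IsSolutionOn L (HamiltonJacobi.constraintSet L f) X) :
    (∀ q ∈ HamiltonJacobi.baseSet L f,
        mfderiv 𝓘(ℝ, E) (HamiltonJacobi.cotangentModel E) (HamiltonJacobi.toCotangent γ) q
            (HamiltonJacobi.reducedField γ X q) =
          X (HamiltonJacobi.toCotangent γ q)) ↔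
      ∀ q ∈ HamiltonJacobi.baseSet L f,
        mfderiv 𝓘(ℝ, E) 𝓘(ℝ, ℝ)
          (fun q' ↦ HamiltonJacobi.constrainedHamiltonian L (HamiltonJacobi.toCotangent γ q')) q
          = 0 := by
  exact forall₂_congr fun q hq ↦ HamiltonJacobi.mfderiv_toCotangent_eq_iff hL hreg hγ hγ₁ q
    (hX.solves _ (hγf q hq))
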